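/- Let $n\ge 1$ be an integer, let ${\rm H}_n=\{\pm1\}^n\rtimes {\rm S}_n$ be the hyperoctahedral group (with ${\rm S}_n$ permuting coordinates), let $\pi:{\rm H}_n\to {\rm S}_n$ be the canonical projection, let $-1=(-1,\dots,-1)\in\{\pm1\}^n\subset {\rm H}_n$, and view $\{\pm 1\}$ as the subgroup generated by this element. Let $\epsilon$ be the signature, and let ${\rm S}_n^\epsilon=\{\epsilon(\sigma)\sigma : \sigma\in {\rm S}_n\}\subset {\rm H}_n$. Conjugate means conjugate in ${\rm H}_n$. For any choice of $v_1,\dots,v_4$ with $(\mathbb{Z}/3)^2-\{0\}=\coprod_{i=1}^4\{v_i,-v_i\}$, let $\iota:{\rm GL}_2(\mathbb{Z}/3)\to {\rm H}_4$ be the group embedding given by $\iota(g)=u\,\sigma$, where $u=(u_i)\in\{\pm1\}^4$ and $\sigma\in {\rm S}_4$ are determined by $g v_j=u_{\sigma(j)}\,v_{\sigma(j)}$ for $j=1,\dots,4$. (i) Let $G$ be a subgroup of ${\rm H}_n$ of order $n!$ with $\pi(G)={\rm S}_n$. Then $G$ is conjugate to ${\rm S}_n$ or to ${\rm S}_n^\epsilon$.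 Moreover, ${\rm S}_n$ and ${\rm S}_n^\epsilon$ are conjugate in ${\rm H}_n$ if, and only if, $n\le 2$. (ii) Let $G$ be a subgroup of ${\rm H}_n$ of order $2\cdot n!$ with $\pi(G)={\rm S}_n$. Then $-1\in G$ and, for every choice of $v_1,\dots,v_4$ as above, exactly one of the following properties holds: (a) $G$ is conjugate to $\{\pm1\}\cdot {\rm S}_n$; (b) $n=2$ and $G\simeq\mathbb{Z}/4$; (c) $n=4$ and $G$ is conjugate to $\iota({\rm GL}_2(\mathbb{Z}/3))$. -/

import Mathlib

open scoped Nat Matrix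

/-- The hyperoctahedral group `{±1}ⁿ ⋊ Sₙ`, where `Sₙ` permutes the coordinates:
`(σ • u) i = u (σ⁻¹ i)`. -/
abbrev Hyperoctahedral (n : ℕ) : Type :=
  (Fin n → ℤˣ) ⋊[mulAutArrow] (Equiv.Perm (Fin n))

namespace Hyperoctahedral

/-- The canonical projection `π : Hₙ → Sₙ`. -/
abbrev proj (n : ℕ) : Hyperoctahedral n →* Equiv.Perm (Fin n) :=
  SemidirectProduct.rightHom

/-- The diagonal embedding `{±1} → {±1}ⁿ ⊆ Hₙ`. -/
def diag (n : ℕ) : ℤˣ →* Hyperoctahedral n where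
  toFun s := SemidirectProduct.inl (fun _ => s)
  map_one' := rfl
  map_mul' s t := by
    rw [← map_mul]
    rfl

/-- The element `-1` of `Hₙ`, all of whose coordinates are `-1`. -/
def negOne (n : ℕ) : Hyperoctahedral n := diag n (-1)

theorem diag_mul_comm (n : ℕ) (s : ℤˣ) (h : Hyperoctahedral n) :
    diag n s * h = h * diag n s := by
  apply SemidirectProduct.ext
  · funext i
    exact mul_comm s (h.left i)
  · exact (one_mul h.right).trans (mul_one h.right).symm

/-- The natural subgroup `Sₙ` of `Hₙ`. -/
def symm (n : ℕ) : Subgroup (Hyperoctahedral n) :=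
  (SemidirectProduct.inr : Equiv.Perm (Fin n) →* Hyperoctahedral n).range

/-- The homomorphism `σ ↦ ε(σ) σ` from `Sₙ` to `Hₙ`, with `ε` the signature. -/
def twist (n : ℕ) : Equiv.Perm (Fin n) →* Hyperoctahedral n where
  toFun σ := diag n (Equiv.Perm.sign σ) * SemidirectProduct.inr σ
  map_one' := by simp
  map_mul' σ τ := by
    rw [map_mul, map_mul, map_mul, mul_assoc, mul_assoc,
      ← mul_assoc (diag n (Equiv.Perm.sign τ)), diag_mul_comm n (Equiv.Perm.sign τ),
      mul_assoc]

/-- The subgroup `Sₙ^ε` of the elements `ε(σ) σ`, for `σ` in `Sₙ`. -/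
def symmTwist (n : ℕ) : Subgroup (Hyperoctahedral n) := (twist n).range

/-- The homomorphism `(s, σ) ↦ s σ` from `{±1} × Sₙ` to `Hₙ`. -/
def signMul (n : ℕ) : ℤˣ × Equiv.Perm (Fin n) →* Hyperoctahedral n where
  toFun p := diag n p.1 * SemidirectProduct.inr p.2
  map_one' := by simp
  map_mul' p q := by
    rw [Prod.fst_mul, Prod.snd_mul, map_mul, map_mul, mul_assoc, mul_assoc,
      ← mul_assoc (diag n q.1), diag_mul_comm n q.1, mul_assoc]

/-- The subgroup `{±1} · Sₙ` of `Hₙ`. -/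
def signSymm (n : ℕ) : Subgroup (Hyperoctahedral n) := (signMul n).range

/-- `v₁, v₂, v₃, v₄` are representatives of the four pairs `{w, -w}` of nonzero vectors of
`(ℤ/3)²`, that is, `(ℤ/3)² - {0}` is the disjoint union of the sets `{vᵢ, -vᵢ}`. -/
def IsPairReps (v : Fin 4 → Fin 2 → ZMod 3) : Prop :=
  (∀ i, v i ≠ 0) ∧ ∀ w : Fin 2 → ZMod 3, w ≠ 0 → ∃! i, w = v i ∨ w = -v i

/-- Such representatives exist. -/
theorem isPairReps_example : IsPairReps ![![0, 1], ![1, 0], ![1, 1], ![1, -1]] := by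
  unfold IsPairReps ExistsUnique
  decide

/-- The element `h = u σ` of `H₄` describes the action of the matrix `g` on the representatives:
`g vⱼ = u_{σ(j)} v_{σ(j)}` for all `j`. -/
def Describes (v : Fin 4 → Fin 2 → ZMod 3) (g : GL (Fin 2) (ZMod 3))
    (h : Hyperoctahedral 4) : Prop :=
  ∀ j, g.val *ᵥ v j = (h.left (h.right j)).val • v (h.right j)

theorem zmod_three_vec_ne_neg (w : Fin 2 → ZMod 3) (hw : w ≠ 0) : w ≠ -w := by
  revert w
  decide

theorem gl_mulVec_injective (g : GL (Fin 2) (ZMod 3)) :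
    Function.Injective (fun w : Fin 2 → ZMod 3 => g.val *ᵥ w) := by
  intro a b hab
  have h : (g⁻¹).val *ᵥ (g.val *ᵥ a) = (g⁻¹).val *ᵥ (g.val *ᵥ b) :=
    congrArg (fun w => (g⁻¹).val *ᵥ w) hab
  rwa [Matrix.mulVec_mulVec, Matrix.mulVec_mulVec, Units.inv_mul, Matrix.one_mulVec,
    Matrix.one_mulVec] at h

theorem gl_mulVec_ne_zero (g : GL (Fin 2) (ZMod 3)) {w : Fin 2 → ZMod 3} (hw : w ≠ 0) :
    g.val *ᵥ w ≠ 0 := fun h =>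
  hw (gl_mulVec_injective g (by simpa using h))

theorem IsPairReps.eq_of_smul_eq {v : Fin 4 → Fin 2 → ZMod 3} (hv : IsPairReps v)
    {s t : ℤˣ} {i j : Fin 4} (h : s.val • v i = t.val • v j) : i = j ∧ s = t := by
  have hij : i = j := by
    refine (hv.2 (v i) (hv.1 i)).unique (Or.inl rfl) ?_
    rcases Int.units_eq_one_or s with rfl | rfl <;> rcases Int.units_eq_one_or t with rfl | rfl <;>
      simp_all [neg_eq_iff_eq_neg]
  subst hij
  refine ⟨rfl, ?_⟩
  have hne := zmod_three_vec_ne_neg (v i) (hv.1 i)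
  rcases Int.units_eq_one_or s with rfl | rfl <;> rcases Int.units_eq_one_or t with rfl | rfl
  · rfl
  · exact absurd (by simpa using h) hne
  · exact absurd (by simpa using h.symm) hne
  · rfl

theorem IsPairReps.existsUnique_describes {v : Fin 4 → Fin 2 → ZMod 3} (hv : IsPairReps v)
    (g : GL (Fin 2) (ZMod 3)) : ∃! h : Hyperoctahedral 4, Describes v g h := by
  have key : ∀ j, ∃ i, ∃ s : ℤˣ, g.val *ᵥ v j = s.val • v i := by
    intro j
    obtain ⟨i, hi, -⟩ := hv.2 _ (gl_mulVec_ne_zero g (hv.1 j))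
    rcases hi with hi | hi
    · exact ⟨i, 1, by simpa using hi⟩
    · exact ⟨i, -1, by simpa using hi⟩
  choose f s hfs using key
  have hinj : Function.Injective f := by
    intro j k hjk
    have hs : s j = s k ∨ s j = -s k := by
      rcases Int.units_eq_one_or (s j) with h | h <;>
        rcases Int.units_eq_one_or (s k) with h' | h' <;> simp [h, h']
    refine (hv.2 (v j) (hv.1 j)).unique (Or.inl rfl) ?_
    rcases hs with h | h
    · left
      apply gl_mulVec_injective g
      simp only [hfs, hjk, h]
    · right
      apply gl_mulVec_injective g
      simp only [Matrix.mulVec_neg, hfs, hjk, h, Units.val_neg, neg_smul]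
  have hbij : Function.Bijective f := Finite.injective_iff_bijective.1 hinj
  let σ : Equiv.Perm (Fin 4) := Equiv.ofBijective f hbij
  refine ⟨⟨fun i => s (σ.symm i), σ⟩, ?_, ?_⟩
  · intro j
    have : σ.symm (σ j) = j := σ.symm_apply_apply j
    simp only [this]
    exact hfs j
  · intro h hh
    have e : ∀ j, h.right j = σ j ∧ h.left (h.right j) = s j := fun j =>
      hv.eq_of_smul_eq ((hh j).symm.trans (hfs j))
    apply SemidirectProduct.ext
    · funext i
      have := (e (σ.symm i)).2
      rwa [(e (σ.symm i)).1, Equiv.apply_symm_apply] at this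
    · exact Equiv.ext fun j => (e j).1

theorem describes_one (v : Fin 4 → Fin 2 → ZMod 3) : Describes v 1 1 := by
  intro j
  simp

theorem Describes.mul {v : Fin 4 → Fin 2 → ZMod 3} {g g' : GL (Fin 2) (ZMod 3)}
    {h h' : Hyperoctahedral 4} (H : Describes v g h) (H' : Describes v g' h') :
    Describes v (g * g') (h * h') := by
  intro j
  have e : (h * h').left ((h * h').right j)
      = h.left (h.right (h'.right j)) * h'.left (h'.right j) := by
    change h.left (h.right (h'.right j))
      * h'.left (h.right⁻¹ (h.right (h'.right j))) = _
    exact congrArg (fun i => _ * h'.left i) (h.right.symm_apply_apply (h'.right j))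
  rw [e, Units.val_mul, ← Matrix.mulVec_mulVec, H' j, Matrix.mulVec_smul, H, smul_smul,
    Units.val_mul, mul_comm]
  rfl

/-- The embedding `ι : GL₂(ℤ/3) → H₄` attached to the choice of representatives `v₁, …, v₄`:
`ι(g) = u σ` where `g vⱼ = u_{σ(j)} v_{σ(j)}` for all `j`. -/
noncomputable def iota (v : Fin 4 → Fin 2 → ZMod 3) (hv : IsPairReps v) :
    GL (Fin 2) (ZMod 3) →* Hyperoctahedral 4 where
  toFun g := (hv.existsUnique_describes g).choose
  map_one' := (hv.existsUnique_describes 1).unique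
    (hv.existsUnique_describes 1).choose_spec.1 (describes_one v)
  map_mul' g g' := (hv.existsUnique_describes (g * g')).unique
    (hv.existsUnique_describes (g * g')).choose_spec.1
    ((hv.existsUnique_describes g).choose_spec.1.mul (hv.existsUnique_describes g').choose_spec.1)

theorem iota_describes (v : Fin 4 → Fin 2 → ZMod 3) (hv : IsPairReps v)
    (g : GL (Fin 2) (ZMod 3)) : Describes v g (iota v hv g) :=
  (hv.existsUnique_describes g).choose_spec.1

/-- Two subgroups `K` and `L` of a group are conjugate: `L = g K g⁻¹` for some `g`. -/
def ConjSubgroups {Γ : Type*} [Group Γ] (K L : Subgroup Γ) : Prop :=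
  ∃ g : Γ, L = K.map (MulAut.conj g).toMonoidHom

/-- Exactly one of three propositions holds. -/
def ExactlyOne (a b c : Prop) : Prop :=
  (a ∨ b ∨ c) ∧ ¬(a ∧ b) ∧ ¬(a ∧ c) ∧ ¬(b ∧ c)

end Hyperoctahedral

/-!
A signed permutation `h` is determined by its permutation and by the signs `coeff h a` with which it
acts on the basis vectors `eₐ`. For a group mapping isomorphically onto the symmetric group these
signs form a cocycle, and `Equiv.Perm.signCocycle_eq` shows that it is, up to a coboundary, trivial
or the signature: by Shapiro's lemma it is determined by the character through which the stabilizer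
of a point acts on its basis vector, and the only characters of a symmetric group are `1` and the
signature. Coboundaries amount to conjugation by diagonal matrices, which gives part (i). A
transposition of three or more letters has a fixed point, which tells `Sₙ` from `Sₙ^ε` if `n ≥ 3`.

In part (ii), the diagonal matrices in `G` form a group of order two stable under permutations, hence
equal to `{±1}` (`isSignExtension_of_card`). For `n ≥ 3`, fix two points `o` and `p`. The stabilizer
of `e_o` in `G` is isomorphic to the symmetric group on the other points, so by the cocycle lemma it
may be assumed to consist of the permutation matrices, or, if `n ≥ 4`, of their twists by the
signature away from `o` (`IsSignExtension.exists_conj_stabilizer`). It remains to locate a lift `t`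
of `swap o p`, which generates `G` together with this stabilizer and `-1`. Its commutators with
the lifts of transpositions of the other points are `±1`. In the untwisted case this makes the signs
of `t` away from `o` and `p` equal, and `G` is conjugate to `{±1} · Sₙ`
(`IsSignExtension.conjSubgroups_signSymm`). In the twisted case it makes them pairwise opposite, so
that `n = 4` and `G` is conjugate to one explicit subgroup `exceptional`.

The image of `GL₂(ℤ/3)` satisfies the hypotheses of (ii) and, having an element of order `8`, is not
conjugate to `{±1} · S₄`. Hence it is conjugate to `exceptional` for every choice of the `vᵢ`, without
any computation of the embedding.
-/

/-! ### Sign cocycles of the symmetric group -/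

namespace Equiv.Perm

variable {α : Type*} [DecidableEq α]

theorem hom_eq_one_or_eq_sign [Fintype α] (f : Perm α →* ℤˣ) : f = 1 ∨ f = sign := by
  by_cases h : ∃ σ, f σ = -1
  · obtain ⟨σ, hσ⟩ := h
    refine .inr (eq_sign_of_surjective_hom fun u => ?_)
    rcases Int.units_eq_one_or u with rfl | rfl
    exacts [⟨1, map_one f⟩, ⟨σ, hσ⟩]
  · exact .inl (MonoidHom.ext fun σ =>
      (Int.units_eq_one_or (f σ)).resolve_right fun hσ => h ⟨σ, hσ⟩)

theorem ofSubtype_surjOn_stabilizer {o : α} {σ : Perm α} (h : σ o = o) :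
    ∃ ρ : Perm {x // x ≠ o}, ofSubtype ρ = σ := by
  have h₁ : ∀ x, σ x ≠ o ↔ x ≠ o := fun x => by
    rw [not_iff_not]
    exact ⟨fun hx => σ.injective (hx.trans h.symm), fun hx => hx ▸ h⟩
  exact ⟨σ.subtypePerm h₁, ofSubtype_subtypePerm h₁ fun x hx hxo => hx (hxo ▸ h)⟩

/-- A sign cocycle that is trivial on the stabilizer of a point is a coboundary. -/
theorem signCocycle_eq_of_stabilizer (w : Perm α → α → ℤˣ)
    (hw : ∀ σ τ a, w (σ * τ) a = w σ (τ a) * w τ a) (o : α)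
    (h : ∀ σ : Perm α, σ o = o → w σ o = 1) :
    ∃ d : α → ℤˣ, ∀ σ a, w σ a = d (σ a) * d a := by
  have key : ∀ σ : Perm α, w σ o = w (swap o (σ o)) o := fun σ => by
    have h' := hw (swap o (σ o)) (swap o (σ o) * σ) o
    rwa [← mul_assoc, swap_mul_self, one_mul, mul_apply, swap_apply_right,
      h (swap o (σ o) * σ) (by simp), mul_one] at h'
  refine ⟨fun a => w (swap o a) o, fun σ a => ?_⟩
  have h₁ := key (σ * swap o a)
  rw [hw, mul_apply, swap_apply_left] at h₁
  exact (mul_inv_eq_iff_eq_mul.2 h₁.symm).symm.trans (by rw [Int.units_inv_eq_self])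

/-- On at most two points the signature itself is a coboundary. -/
theorem sign_eq_of_card_le_two [Fintype α] (h : Fintype.card α ≤ 2) :
    ∃ d : α → ℤˣ, ∀ (σ : Perm α) a, sign σ = d (σ a) * d a := by
  obtain ⟨d⟩ := Function.Embedding.nonempty_of_card_le (α := α) (β := ℤˣ) (by simpa using h)
  -- An injective `d` works: there is no room for a third point.
  have third : ∀ x y z : α, x ≠ y → z = x ∨ z = y := fun x y z hxy => by
    by_contra! hz
    have h₁ := d.injective.ne hxy
    have h₂ := d.injective.ne hz.1
    have h₃ := d.injective.ne hz.2
    generalize d x = u at *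
    generalize d y = v at *
    generalize d z = w at *
    revert u v w
    decide
  refine ⟨d, fun σ a => ?_⟩
  by_cases ha : σ a = a
  · have : σ = 1 := Equiv.ext fun x => by
      by_contra! hx
      have hxa : x ≠ a := fun e => hx (e ▸ ha)
      rcases third x a (σ x) hxa with e | e
      · exact hx e
      · exact hxa (σ.injective (e.trans ha.symm))
    rw [this, map_one, one_apply, Int.units_mul_self]
  · have : σ = swap a (σ a) := Equiv.ext fun x => by
      rcases third a (σ a) x (Ne.symm ha) with rfl | rfl
      · rw [swap_apply_left]
      · rw [swap_apply_right]
        rcases third a (σ a) (σ (σ a)) (Ne.symm ha) with e | e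
        · exact e
        · exact absurd (σ.injective e) ha
    have h₁ := d.injective.ne ha
    rw [this, sign_swap (Ne.symm ha), swap_apply_left]
    generalize d a = u at *
    generalize d (σ a) = v at *
    revert u v
    decide

/-- The first cohomology of `Perm α` with values in the signs on `α` is, by Shapiro's lemma, the
group of characters `{1, sign}` of the stabilizer of a point: up to a coboundary, a sign cocycle
is trivial or equal to the signature, and the second case is needed on three or more points
only. -/
theorem signCocycle_eq [Fintype α] (w : Perm α → α → ℤˣ)
    (hw : ∀ σ τ a, w (σ * τ) a = w σ (τ a) * w τ a) :
    ∃ d : α → ℤˣ, (∀ σ a, w σ a = d (σ a) * d a) ∨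
      2 < Fintype.card α ∧ ∀ σ a, w σ a = sign σ * (d (σ a) * d a) := by
  rcases isEmpty_or_nonempty α with _ | ⟨⟨o⟩⟩
  · exact ⟨1, .inl fun σ a => isEmptyElim a⟩
  have hfix : ∀ ρ : Perm {x // x ≠ o}, ofSubtype ρ o = o := fun ρ =>
    ofSubtype_apply_of_not_mem ρ (by simp)
  let χ : Perm {x // x ≠ o} →* ℤˣ := MonoidHom.mk' (fun ρ => w (ofSubtype ρ) o) fun ρ ρ' => by
    rw [map_mul, hw, hfix]
  rcases hom_eq_one_or_eq_sign χ with h | h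
  · obtain ⟨d, hd⟩ := signCocycle_eq_of_stabilizer w hw o fun σ hσ => by
      obtain ⟨ρ, rfl⟩ := ofSubtype_surjOn_stabilizer hσ
      exact DFunLike.congr_fun h ρ
    exact ⟨d, .inl hd⟩
  · obtain ⟨d, hd⟩ := signCocycle_eq_of_stabilizer (fun σ a => sign σ * w σ a)
      (fun σ τ a => by rw [hw, map_mul, mul_mul_mul_comm]) o fun σ hσ => by
        obtain ⟨ρ, rfl⟩ := ofSubtype_surjOn_stabilizer hσ
        have hρ : w (ofSubtype ρ) o = sign ρ := DFunLike.congr_fun h ρ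
        rw [hρ, sign_ofSubtype, Int.units_mul_self]
    have hwd : ∀ σ a, w σ a = sign σ * (d (σ a) * d a) := fun σ a => by
      rw [← hd, ← mul_assoc, Int.units_mul_self, one_mul]
    rcases lt_or_ge 2 (Fintype.card α) with hα | hα
    · exact ⟨d, .inr ⟨hα, hwd⟩⟩
    · obtain ⟨d', hd'⟩ := sign_eq_of_card_le_two hα
      refine ⟨d' * d, .inl fun σ a => ?_⟩
      rw [hwd, hd' σ a, Pi.mul_apply, Pi.mul_apply, mul_mul_mul_comm]

/-- The stabilizer of `o` has two double cosets, represented by `1` and `swap o p`. -/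
theorem eq_top_of_stabilizer_of_swap {H : Subgroup (Perm α)} {o p : α} (hop : o ≠ p)
    (h : ∀ σ : Perm α, σ o = o → σ ∈ H) (hs : swap o p ∈ H) : H = ⊤ := by
  refine eq_top_iff.2 fun τ _ => ?_
  by_cases hτ : τ o = o
  · exact h τ hτ
  have hρ : swap p (τ o) o = o := swap_apply_of_ne_of_ne hop (Ne.symm hτ)
  have h₁ : swap o p * (swap p (τ o) * τ) ∈ H := h _ (by simp)
  have h₂ := H.mul_mem (H.mul_mem (h _ hρ) hs) h₁
  simpa [mul_assoc] using h₂

end Equiv.Perm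

/-! ### Signed permutations -/

namespace Hyperoctahedral

variable {n : ℕ}

/-- The sign with which `h` acts on the `a`-th basis vector: `h eₐ = coeff h a • e_{h.right a}`. -/
def coeff (h : Hyperoctahedral n) (a : Fin n) : ℤˣ := h.left (h.right a)

theorem ext_coeff {h h' : Hyperoctahedral n} (hr : h.right = h'.right)
    (hc : ∀ a, coeff h a = coeff h' a) : h = h' := by
  refine SemidirectProduct.ext (funext fun i => ?_) hr
  have := hc (h.right⁻¹ i)
  rw [coeff, coeff, ← hr] at this
  simpa using this

theorem coeff_mul (h h' : Hyperoctahedral n) (a : Fin n) :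
    coeff (h * h') a = coeff h (h'.right a) * coeff h' a := by
  change h.left (h.right (h'.right a)) * h'.left (h.right⁻¹ (h.right (h'.right a))) = _
  exact congrArg (fun i => _ * h'.left i) (h.right.symm_apply_apply (h'.right a))

@[simp] theorem coeff_one (a : Fin n) : coeff (1 : Hyperoctahedral n) a = 1 := rfl

@[simp] theorem coeff_inr (σ : Equiv.Perm (Fin n)) (a : Fin n) :
    coeff (SemidirectProduct.inr σ : Hyperoctahedral n) a = 1 := rfl

@[simp] theorem coeff_inl (d : Fin n → ℤˣ) (a : Fin n) :
    coeff (SemidirectProduct.inl d : Hyperoctahedral n) a = d a := rfl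

@[simp] theorem coeff_diag (s : ℤˣ) (a : Fin n) : coeff (diag n s) a = s := rfl

@[simp] theorem right_diag (s : ℤˣ) : (diag n s).right = 1 := rfl

@[simp] theorem coeff_negOne (a : Fin n) : coeff (negOne n) a = -1 := rfl

@[simp] theorem right_negOne : (negOne n).right = 1 := rfl

@[simp] theorem right_twist (σ : Equiv.Perm (Fin n)) : (twist n σ).right = σ := rfl

@[simp] theorem coeff_twist (σ : Equiv.Perm (Fin n)) (a : Fin n) :
    coeff (twist n σ) a = Equiv.Perm.sign σ := by
  change coeff (diag n (Equiv.Perm.sign σ) * SemidirectProduct.inr σ) a = _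
  simp [coeff_mul]

theorem coeff_inv (h : Hyperoctahedral n) (a : Fin n) :
    coeff h⁻¹ (h.right a) = coeff h a := by
  have := coeff_mul h⁻¹ h a
  rw [inv_mul_cancel, coeff_one] at this
  exact (mul_eq_one_iff_eq_inv.1 this.symm).trans (Int.units_inv_eq_self _)

theorem right_conj_inl (d : Fin n → ℤˣ) (h : Hyperoctahedral n) :
    (MulAut.conj (SemidirectProduct.inl d) h).right = h.right := by
  simp [MulAut.conj_apply]

theorem coeff_conj_inl (d : Fin n → ℤˣ) (h : Hyperoctahedral n) (a : Fin n) :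
    coeff (MulAut.conj (SemidirectProduct.inl d) h) a = d (h.right a) * coeff h a * d a := by
  have hd : ((SemidirectProduct.inl d)⁻¹ : Hyperoctahedral n) = SemidirectProduct.inl d := by
    rw [← map_inv]
    exact congrArg _ (funext fun i => Int.units_inv_eq_self _)
  simp [MulAut.conj_apply, coeff_mul, hd]

/-! ### Conjugate subgroups and complements of the sign group -/

theorem ConjSubgroups.symm {Γ : Type*} [Group Γ] {K L : Subgroup Γ} (h : ConjSubgroups K L) :
    ConjSubgroups L K := by
  obtain ⟨g, rfl⟩ := h
  refine ⟨g⁻¹, ?_⟩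
  ext x
  simp [Subgroup.mem_map, mul_assoc]

theorem ConjSubgroups.trans {Γ : Type*} [Group Γ] {K L M : Subgroup Γ}
    (h : ConjSubgroups K L) (h' : ConjSubgroups L M) : ConjSubgroups K M := by
  obtain ⟨g, rfl⟩ := h
  obtain ⟨g', rfl⟩ := h'
  refine ⟨g' * g, ?_⟩
  ext x
  simp [Subgroup.mem_map, mul_assoc]

/-- Conjugate subgroups satisfy the same power laws. -/
theorem ConjSubgroups.pow_eq_one {Γ : Type*} [Group Γ] {K L : Subgroup Γ}
    (h : ConjSubgroups K L) {m : ℕ} (hL : ∀ x ∈ L, x ^ m = 1) : ∀ x ∈ K, x ^ m = 1 := by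
  obtain ⟨g, rfl⟩ := h
  intro x hx
  have := hL _ (Subgroup.mem_map_of_mem _ hx)
  rw [← map_pow] at this
  exact (MulAut.conj g).injective (this.trans (map_one _).symm)

theorem exists_mem_right_eq {G : Subgroup (Hyperoctahedral n)} (h : G.map (proj n) = ⊤)
    (σ : Equiv.Perm (Fin n)) : ∃ g ∈ G, g.right = σ := by
  have : σ ∈ G.map (proj n) := h ▸ Subgroup.mem_top σ
  exact this

theorem card_ker_mul_factorial {G : Subgroup (Hyperoctahedral n)} (h : G.map (proj n) = ⊤) :
    Nat.card ((proj n).ker.subgroupOf G) * n ! = Nat.card G := by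
  have h₁ := Subgroup.relIndex_ker G (proj n)
  rw [h, Subgroup.card_top, Nat.card_perm, Nat.card_fin] at h₁
  rw [← h₁]
  exact Subgroup.card_mul_index _

/-- A diagonal matrix conjugating every element of `G` onto the value of a section `f` of `π`
conjugates `G` onto the image of `f`. -/
theorem conjSubgroups_range {G : Subgroup (Hyperoctahedral n)} (hG : G.map (proj n) = ⊤)
    (f : Equiv.Perm (Fin n) →* Hyperoctahedral n) (d : Fin n → ℤˣ)
    (hf : ∀ g ∈ G, MulAut.conj (SemidirectProduct.inl d) g = f g.right) :
    ConjSubgroups G f.range := by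
  refine ⟨SemidirectProduct.inl d, ?_⟩
  ext x
  constructor
  · rintro ⟨σ, rfl⟩
    obtain ⟨g, hg, rfl⟩ := exists_mem_right_eq hG σ
    exact ⟨g, hg, hf g hg⟩
  · rintro ⟨g, hg, rfl⟩
    exact ⟨g.right, (hf g hg).symm⟩

theorem conjSubgroups_symm_or_symmTwist {G : Subgroup (Hyperoctahedral n)}
    (hcard : Nat.card G = n !) (hG : G.map (proj n) = ⊤) :
    ConjSubgroups G (symm n) ∨ ConjSubgroups G (symmTwist n) := by
  have hker := card_ker_mul_factorial hG
  rw [hcard, Nat.mul_eq_right (Nat.factorial_ne_zero n), Subgroup.card_eq_one] at hker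
  have hinj : ∀ g ∈ G, ∀ g' ∈ G, g.right = g'.right → g = g' := fun g hg g' hg' h => by
    have h₁ : (⟨g * g'⁻¹, G.mul_mem hg (G.inv_mem hg')⟩ : G) ∈ (proj n).ker.subgroupOf G := by
      simp [Subgroup.mem_subgroupOf, h]
    rw [hker, Subgroup.mem_bot, Subtype.ext_iff] at h₁
    exact mul_inv_eq_one.1 h₁
  choose s hs hsr using exists_mem_right_eq hG
  have hmul : ∀ σ τ, s (σ * τ) = s σ * s τ := fun σ τ =>
    hinj _ (hs _) _ (G.mul_mem (hs _) (hs _)) (by simp [hsr])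
  obtain ⟨d, h⟩ := Equiv.Perm.signCocycle_eq (fun σ a => coeff (s σ) a) fun σ τ a => by
    rw [hmul, coeff_mul, hsr]
  have cancel : ∀ x y : ℤˣ, x * (x * y) * y = 1 := by decide
  have cancel' : ∀ x y z : ℤˣ, x * (z * (x * y)) * y = z := by decide
  refine h.imp (fun h => conjSubgroups_range hG _ d fun g hg => ?_)
    fun ⟨_, h⟩ => conjSubgroups_range hG _ d fun g hg => ?_
  all_goals
    have hgs : s g.right = g := hinj _ (hs _) _ hg (hsr _)
    refine ext_coeff (right_conj_inl d g) fun a => ?_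
    have h₁ := h g.right a
    rw [hgs] at h₁
    rw [coeff_conj_inl, h₁]
  · rw [cancel, coeff_inr]
  · rw [cancel', coeff_twist]

theorem conjSubgroups_symm_symmTwist_iff :
    ConjSubgroups (symm n) (symmTwist n) ↔ n ≤ 2 := by
  constructor
  · rintro ⟨h, e⟩
    by_contra! hn
    -- A transposition fixes a basis vector, hence so do its conjugates, whereas all the signs of
    -- `twist n τ` are `-1` if `τ` is odd.
    let σ : Equiv.Perm (Fin n) := Equiv.swap ⟨0, by omega⟩ ⟨1, by omega⟩
    let c : Fin n := ⟨2, by omega⟩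
    have hσc : σ c = c := Equiv.swap_apply_of_ne_of_ne (by simp [c]) (by simp [c])
    have hσ : Equiv.Perm.sign σ = -1 := Equiv.Perm.sign_swap (by simp)
    have hmem : MulAut.conj h (SemidirectProduct.inr σ) ∈ symmTwist n := by
      rw [e]
      exact Subgroup.mem_map_of_mem _ ⟨σ, rfl⟩
    obtain ⟨τ, hτ⟩ := hmem
    have h₁ : τ = h.right * σ * h.right⁻¹ := by
      simpa using congrArg SemidirectProduct.right hτ
    have h₂ : Equiv.Perm.sign τ = -1 := by
      rw [h₁, map_mul, map_mul, map_inv, mul_right_comm, mul_inv_cancel, one_mul, hσ]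
    have h₃ := congrArg (fun x => coeff x (h.right c)) hτ
    simp [coeff_mul, MulAut.conj_apply, coeff_inv, hσc, h₂, Int.units_mul_self] at h₃
  · intro hn
    obtain ⟨d, hd⟩ := Equiv.Perm.sign_eq_of_card_le_two (α := Fin n) (by simpa using hn)
    refine conjSubgroups_range ?_ (twist n) d ?_
    · refine eq_top_iff.2 fun σ _ => ⟨SemidirectProduct.inr σ, ⟨σ, rfl⟩, rfl⟩
    · rintro _ ⟨σ, rfl⟩
      refine ext_coeff (right_conj_inl d _) fun a => ?_
      rw [coeff_conj_inl, coeff_inr, mul_one, coeff_twist]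
      exact (hd σ a).symm

/-! ### Subgroups that are extensions of the symmetric group by the signs -/

/-- `G` surjects onto the symmetric group and its diagonal matrices are exactly `1` and `-1`. -/
structure IsSignExtension (G : Subgroup (Hyperoctahedral n)) : Prop where
  map_eq_top : G.map (proj n) = ⊤
  negOne_mem : negOne n ∈ G
  eq_of_right_eq_one : ∀ g ∈ G, g.right = 1 → g = 1 ∨ g = negOne n

theorem negOne_ne_one (hn : 1 ≤ n) : negOne n ≠ 1 := fun h =>
  absurd (congrArg (fun x => coeff x ⟨0, hn⟩) h) (by simp)

theorem conj_negOne (h : Hyperoctahedral n) : MulAut.conj h (negOne n) = negOne n := by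
  rw [MulAut.conj_apply, negOne, ← diag_mul_comm, mul_inv_cancel_right]

/-- The diagonal matrices in `G` form a group of order two that is stable under permutations of
the coordinates, so its nontrivial element has equal coordinates. -/
theorem isSignExtension_of_card (hn : 1 ≤ n) {G : Subgroup (Hyperoctahedral n)}
    (hcard : Nat.card G = 2 * n !) (hG : G.map (proj n) = ⊤) : IsSignExtension G := by
  have hker := card_ker_mul_factorial hG
  rw [hcard, Nat.mul_left_inj (Nat.factorial_ne_zero n), Nat.card_eq_two_iff' 1] at hker
  obtain ⟨⟨⟨z, hz⟩, hzr⟩, hz₁, huniq⟩ := hker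
  replace hzr : z.right = 1 := hzr
  replace hz₁ : z ≠ 1 := fun e => hz₁ (Subtype.ext (Subtype.ext e))
  replace huniq : ∀ g ∈ G, g.right = 1 → g ≠ 1 → g = z := fun g hg hgr hg₁ => by
    have := huniq ⟨⟨g, hg⟩, hgr⟩ fun e => hg₁ (congrArg (fun x => x.1.1) e)
    exact congrArg (fun x => x.1.1) this
  have hconst : ∀ a b, coeff z a = coeff z b := fun a b => by
    obtain ⟨g, hg, hgr⟩ := exists_mem_right_eq hG (Equiv.swap a b)
    have e : g * z * g⁻¹ = z := huniq _ (G.mul_mem (G.mul_mem hg hz) (G.inv_mem hg))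
      (by simp [hzr]) fun h => hz₁ (by simpa using h)
    have h₁ := congrArg (fun x => coeff x a) (mul_inv_eq_iff_eq_mul.1 e)
    simp only [coeff_mul, hzr, hgr, Equiv.Perm.one_apply, Equiv.swap_apply_left] at h₁
    rw [mul_comm] at h₁
    exact mul_right_cancel h₁
  have hzn : z = negOne n := by
    have h₀ : coeff z ⟨0, hn⟩ = -1 := by
      refine (Int.units_eq_one_or _).resolve_left fun h => hz₁ (ext_coeff hzr fun a => ?_)
      rw [hconst a ⟨0, hn⟩, h, coeff_one]
    exact ext_coeff hzr fun a => (hconst a ⟨0, hn⟩).trans h₀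
  exact ⟨hG, hzn ▸ hz, fun g hg hgr => or_iff_not_imp_left.2 fun h => hzn ▸ huniq g hg hgr h⟩

namespace IsSignExtension

variable {G : Subgroup (Hyperoctahedral n)}

theorem map_conj (hG : IsSignExtension G) (h : Hyperoctahedral n) :
    IsSignExtension (G.map (MulAut.conj h).toMonoidHom) where
  map_eq_top := by
    refine eq_top_iff.2 fun σ _ => ?_
    obtain ⟨g, hg, hgr⟩ := exists_mem_right_eq hG.map_eq_top (h.right⁻¹ * σ * h.right)
    refine ⟨_, ⟨g, hg, rfl⟩, ?_⟩
    simp [hgr, mul_assoc]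
  negOne_mem := ⟨_, hG.negOne_mem, conj_negOne h⟩
  eq_of_right_eq_one := by
    rintro _ ⟨g, hg, rfl⟩ hr
    have hgr : g.right = 1 := by simpa using hr
    rcases hG.eq_of_right_eq_one g hg hgr with rfl | rfl
    · exact .inl (map_one _)
    · exact .inr (conj_negOne h)

theorem diag_mem (hG : IsSignExtension G) (s : ℤˣ) : diag n s ∈ G := by
  rcases Int.units_eq_one_or s with rfl | rfl
  · rw [map_one]
    exact G.one_mem
  · exact hG.negOne_mem

theorem exists_eq_diag_mul (hG : IsSignExtension G) {g g' : Hyperoctahedral n} (hg : g ∈ G)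
    (hg' : g' ∈ G) (h : g.right = g'.right) : ∃ s, g = diag n s * g' := by
  rcases hG.eq_of_right_eq_one (g * g'⁻¹) (G.mul_mem hg (G.inv_mem hg')) (by simp [h]) with e | e
  · exact ⟨1, by rw [map_one, one_mul, mul_inv_eq_one.1 e]⟩
  · exact ⟨-1, mul_inv_eq_iff_eq_mul.1 e⟩

theorem exists_coeff_eq (hG : IsSignExtension G) {g g' : Hyperoctahedral n} (hg : g ∈ G)
    (hg' : g' ∈ G) (h : g.right = g'.right) : ∃ s, ∀ a, coeff g a = s * coeff g' a := by
  obtain ⟨s, rfl⟩ := hG.exists_eq_diag_mul hg hg' h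
  exact ⟨s, fun a => by rw [coeff_mul, coeff_diag]⟩

theorem eq_of_coeff_eq (hG : IsSignExtension G) {g g' : Hyperoctahedral n} (hg : g ∈ G)
    (hg' : g' ∈ G) (h : g.right = g'.right) {o : Fin n} (ho : coeff g o = coeff g' o) :
    g = g' := by
  obtain ⟨s, hs⟩ := hG.exists_coeff_eq hg hg' h
  have hs₁ : s = 1 := mul_eq_right.1 ((hs o).symm.trans ho)
  exact ext_coeff h fun a => by rw [hs, hs₁, one_mul]

theorem exists_mem_coeff_eq_one (hG : IsSignExtension G) (σ : Equiv.Perm (Fin n)) (o : Fin n) :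
    ∃ g ∈ G, g.right = σ ∧ coeff g o = 1 := by
  obtain ⟨g, hg, hgr⟩ := exists_mem_right_eq hG.map_eq_top σ
  exact ⟨_, G.mul_mem (hG.diag_mem (coeff g o)) hg, by simp [hgr],
    by simp [coeff_mul, Int.units_mul_self]⟩

theorem eq_of_le (hG : IsSignExtension G) {K : Subgroup (Hyperoctahedral n)} (hKG : K ≤ G)
    (hneg : negOne n ∈ K) (hK : K.map (proj n) = ⊤) : K = G := by
  refine le_antisymm hKG fun g hg => ?_
  obtain ⟨k, hk, hkr⟩ := exists_mem_right_eq hK g.right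
  rcases hG.eq_of_right_eq_one (g * k⁻¹) (G.mul_mem hg (G.inv_mem (hKG hk))) (by simp [hkr])
    with e | e
  · exact mul_inv_eq_one.1 e ▸ hk
  · exact mul_inv_eq_iff_eq_mul.1 e ▸ K.mul_mem hneg hk

theorem eq_signSymm (hG : IsSignExtension G)
    (h : ∀ σ : Equiv.Perm (Fin n), SemidirectProduct.inr σ ∈ G) : signSymm n = G := by
  refine hG.eq_of_le ?_ ⟨(-1, 1), ?_⟩ (eq_top_iff.2 fun σ _ => ⟨_, ⟨(1, σ), rfl⟩, ?_⟩)
  · rintro _ ⟨⟨s, σ⟩, rfl⟩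
    exact G.mul_mem (hG.diag_mem s) (h σ)
  · simp [signMul, negOne]
  · simp [signMul]

end IsSignExtension

/-- The signed permutation `eₐ ↦ w a • e_{σ a}`. -/
def signedPerm (w : Fin n → ℤˣ) (σ : Equiv.Perm (Fin n)) : Hyperoctahedral n :=
  ⟨fun i => w (σ⁻¹ i), σ⟩

@[simp] theorem right_signedPerm (w : Fin n → ℤˣ) (σ : Equiv.Perm (Fin n)) :
    (signedPerm w σ).right = σ := rfl

@[simp] theorem coeff_signedPerm (w : Fin n → ℤˣ) (σ : Equiv.Perm (Fin n)) (a : Fin n) :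
    coeff (signedPerm w σ) a = w a :=
  congrArg w (σ.symm_apply_apply a)

/-- The signature on the stabilizer of `o`, twisting all coordinates except the `o`-th one. -/
def stabTwist (o : Fin n) (σ : Equiv.Perm (Fin n)) : Hyperoctahedral n :=
  signedPerm (fun a => if a = o then 1 else Equiv.Perm.sign σ) σ

@[simp] theorem right_stabTwist (o : Fin n) (σ : Equiv.Perm (Fin n)) :
    (stabTwist o σ).right = σ := rfl

theorem coeff_stabTwist (o : Fin n) (σ : Equiv.Perm (Fin n)) (a : Fin n) :
    coeff (stabTwist o σ) a = if a = o then 1 else Equiv.Perm.sign σ :=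
  coeff_signedPerm _ _ _

/-- Conjugation by a sign change of the `o`-th coordinate does not affect the signs of an element
whose permutation fixes `o`. -/
theorem conj_single_of_fixed {o : Fin n} (s : ℤˣ) {h : Hyperoctahedral n} (hh : h.right o = o) :
    MulAut.conj (SemidirectProduct.inl fun a => if a = o then s else 1) h = h := by
  refine ext_coeff (right_conj_inl _ h) fun a => ?_
  have : h.right a = o ↔ a = o :=
    ⟨fun e => h.right.injective (e.trans hh.symm), fun e => e ▸ hh⟩
  rw [coeff_conj_inl, if_congr this rfl rfl, mul_right_comm]
  split_ifs <;> simp [Int.units_mul_self]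

namespace IsSignExtension

variable {G : Subgroup (Hyperoctahedral n)}

/-- The stabilizer of the basis vector `e_o` in `G` is a copy of the stabilizer of `o` in the
symmetric group; its action on the other coordinates is a sign cocycle. -/
theorem exists_conj_stabilizer (hG : IsSignExtension G) (o : Fin n) :
    ∃ d : Fin n → ℤˣ,
      (∀ σ : Equiv.Perm (Fin n), σ o = o →
        SemidirectProduct.inr σ ∈ G.map (MulAut.conj (SemidirectProduct.inl d)).toMonoidHom) ∨
      4 ≤ n ∧ ∀ σ : Equiv.Perm (Fin n), σ o = o →
        stabTwist o σ ∈ G.map (MulAut.conj (SemidirectProduct.inl d)).toMonoidHom := by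
  choose s hs hsr hso using fun σ => hG.exists_mem_coeff_eq_one σ o
  have hmul : ∀ σ τ : Equiv.Perm (Fin n), τ o = o → s (σ * τ) = s σ * s τ := fun σ τ hτ =>
    hG.eq_of_coeff_eq (o := o) (hs _) (G.mul_mem (hs _) (hs _)) (by simp [hsr])
      (by simp [coeff_mul, hsr, hso, hτ])
  have hfix : ∀ ρ : Equiv.Perm {x // x ≠ o}, Equiv.Perm.ofSubtype ρ o = o := fun ρ =>
    Equiv.Perm.ofSubtype_apply_of_not_mem ρ (by simp)
  obtain ⟨d₀, hd₀⟩ := Equiv.Perm.signCocycle_eq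
    (fun (ρ : Equiv.Perm {x // x ≠ o}) a => coeff (s (Equiv.Perm.ofSubtype ρ)) a)
    fun σ τ a => by
      rw [map_mul, hmul _ _ (hfix τ), coeff_mul, hsr, Equiv.Perm.ofSubtype_apply_coe]
  let d : Fin n → ℤˣ := fun a => if h : a ≠ o then d₀ ⟨a, h⟩ else 1
  have hdo : d o = 1 := dif_neg (by simp)
  have hd : ∀ a : {x // x ≠ o}, d a = d₀ a := fun a => dif_pos a.2
  have cancel : ∀ x y : ℤˣ, x * (x * y) * y = 1 := by decide
  have cancel' : ∀ x y z : ℤˣ, x * (z * (x * y)) * y = z := by decide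
  refine ⟨d, hd₀.imp (fun h σ hσ => ⟨s σ, hs σ, ?_⟩)
    fun ⟨hc, h⟩ => ⟨?_, fun σ hσ => ⟨s σ, hs σ, ?_⟩⟩⟩
  · refine ext_coeff ((right_conj_inl d _).trans (hsr σ)) fun a => ?_
    refine (coeff_conj_inl d _ a).trans ?_
    obtain ⟨ρ, rfl⟩ := Equiv.Perm.ofSubtype_surjOn_stabilizer hσ
    rw [hsr]
    by_cases ha : a = o
    · simp [ha, hso, hfix, hdo]
    · have h₁ := h ρ ⟨a, ha⟩
      have h₂ := Equiv.Perm.ofSubtype_apply_coe ρ ⟨a, ha⟩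
      have h₃ := hd ⟨a, ha⟩
      dsimp only at h₁ h₂ h₃
      rw [h₁, h₂, hd, h₃, cancel, coeff_inr]
  · simp [Fintype.card_subtype_compl] at hc
    omega
  · refine ext_coeff ((right_conj_inl d _).trans (hsr σ)) fun a => ?_
    refine (coeff_conj_inl d _ a).trans ?_
    obtain ⟨ρ, rfl⟩ := Equiv.Perm.ofSubtype_surjOn_stabilizer hσ
    rw [hsr, coeff_stabTwist]
    by_cases ha : a = o
    · simp [ha, hso, hfix, hdo]
    · have h₁ := h ρ ⟨a, ha⟩
      have h₂ := Equiv.Perm.ofSubtype_apply_coe ρ ⟨a, ha⟩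
      have h₃ := hd ⟨a, ha⟩
      dsimp only at h₁ h₂ h₃
      rw [h₁, h₂, hd, h₃, cancel', if_neg ha, Equiv.Perm.sign_ofSubtype]

/-- A lift of a transposition has equal signs at the two points moved, if there is a third point. -/
theorem exists_lift_swap (hG : IsSignExtension G) {o p q : Fin n} (hqo : q ≠ o) (hqp : q ≠ p) :
    ∃ t ∈ G, t.right = Equiv.swap o p ∧ coeff t o = 1 ∧ coeff t p = 1 := by
  obtain ⟨t, ht, htr, hto⟩ := hG.exists_mem_coeff_eq_one (Equiv.swap o p) o
  -- `t ^ 2` is a sign, which is a square at the third point `q`.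
  obtain ⟨s, hs⟩ := hG.exists_coeff_eq (G.mul_mem ht ht) G.one_mem (by simp [htr])
  have hq := hs q
  have ho := hs o
  simp only [coeff_mul, htr, Equiv.swap_apply_of_ne_of_ne hqo hqp, Equiv.swap_apply_left,
    Int.units_mul_self, coeff_one, mul_one, hto] at hq ho
  exact ⟨t, ht, htr, hto, ho.trans hq.symm⟩

/-- The lifts `t` of `swap o p` and `g` of `swap a b` commute up to a sign `s`; the signs of `t * g`
and `s • (g * t)` are compared at `o` and at `a`. -/
theorem exists_coeff_commutator (hG : IsSignExtension G) {o p a b : Fin n} (hao : a ≠ o)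
    (hap : a ≠ p) (hbo : b ≠ o) (hbp : b ≠ p) {t g : Hyperoctahedral n} (ht : t ∈ G)
    (hg : g ∈ G) (htr : t.right = Equiv.swap o p) (hgr : g.right = Equiv.swap a b) :
    ∃ s, coeff t o * coeff g o = s * (coeff g p * coeff t o) ∧
      coeff t b * coeff g a = s * (coeff g a * coeff t a) := by
  have hcomm : t.right * g.right = g.right * t.right := by
    rw [htr, hgr]
    refine (Equiv.Perm.Disjoint.commute fun x => ?_).eq
    by_cases hx : x = o ∨ x = p
    · right
      rcases hx with rfl | rfl
      exacts [Equiv.swap_apply_of_ne_of_ne hao.symm hbo.symm,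
        Equiv.swap_apply_of_ne_of_ne hap.symm hbp.symm]
    · push Not at hx
      exact .inl (Equiv.swap_apply_of_ne_of_ne hx.1 hx.2)
  obtain ⟨s, hs⟩ := hG.exists_coeff_eq (G.mul_mem ht hg) (G.mul_mem hg ht) (by simp [hcomm])
  refine ⟨s, ?_, ?_⟩
  · simpa only [coeff_mul, htr, hgr, Equiv.swap_apply_left,
      Equiv.swap_apply_of_ne_of_ne hao.symm hbo.symm] using hs o
  · simpa only [coeff_mul, htr, hgr, Equiv.swap_apply_left,
      Equiv.swap_apply_of_ne_of_ne hao hap] using hs a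

/-- If `G` contains the permutation matrices fixing `e_o`, then a lift of `swap o p` has the same
sign `s` at all points other than `o` and `p`; changing the sign of the `o`-th coordinate if
`s = -1` turns it into a multiple of a permutation matrix. -/
theorem conjSubgroups_signSymm (hG : IsSignExtension G) {o p q : Fin n} (hop : o ≠ p)
    (hqo : q ≠ o) (hqp : q ≠ p)
    (h : ∀ σ : Equiv.Perm (Fin n), σ o = o → SemidirectProduct.inr σ ∈ G) :
    ConjSubgroups G (signSymm n) := by
  obtain ⟨t, ht, htr, hto, htp⟩ := hG.exists_lift_swap hqo hqp
  have hconst : ∀ a, a ≠ o → a ≠ p → coeff t a = coeff t q := fun a hao hap => by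
    obtain ⟨s, h₁, h₂⟩ := hG.exists_coeff_commutator hqo hqp hao hap ht
      (h (Equiv.swap q a) (Equiv.swap_apply_of_ne_of_ne hqo.symm hao.symm)) htr rfl
    simp only [coeff_inr, hto, mul_one, one_mul] at h₁ h₂
    rw [h₂, ← h₁, one_mul]
  let x : Hyperoctahedral n := SemidirectProduct.inl fun a => if a = o then coeff t q else 1
  refine ⟨x, ?_⟩
  have hG' := hG.map_conj x
  have hstab : ∀ σ : Equiv.Perm (Fin n), σ o = o →
      SemidirectProduct.inr σ ∈ G.map (MulAut.conj x).toMonoidHom := fun σ hσ =>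
    ⟨_, h σ hσ, conj_single_of_fixed _ hσ⟩
  have hswap : SemidirectProduct.inr (Equiv.swap o p) ∈
      G.map (MulAut.conj x).toMonoidHom := by
    refine ⟨diag n (coeff t q) * t, G.mul_mem (hG.diag_mem _) ht, ?_⟩
    refine ext_coeff ((right_conj_inl _ _).trans (by simp [htr])) fun a => ?_
    refine (coeff_conj_inl _ _ a).trans ?_
    rcases eq_or_ne a o with rfl | hao
    · simp [coeff_mul, htr, hto, hop.symm, Int.units_mul_self]
    rcases eq_or_ne a p with rfl | hap
    · simp [coeff_mul, htr, htp, hop.symm, Int.units_mul_self]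
    · simp [coeff_mul, htr, hao, hap, hconst a hao hap, Equiv.swap_apply_of_ne_of_ne,
        Int.units_mul_self]
  refine hG'.eq_signSymm fun σ => ?_
  have htop : (G.map (MulAut.conj x).toMonoidHom).comap SemidirectProduct.inr = ⊤ :=
    Equiv.Perm.eq_top_of_stabilizer_of_swap hop hstab hswap
  exact Subgroup.mem_comap.1 (htop ▸ Subgroup.mem_top σ)

/-- If the stabilizer of `e_o` is twisted by the signature, then a lift of `swap o p` anticommutes
with the lifts of transpositions of the other points, so it has opposite signs at any two of these
points. -/
theorem exists_lift_swap_alternating (hG : IsSignExtension G) {o p q : Fin n} (hop : o ≠ p)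
    (hqo : q ≠ o) (hqp : q ≠ p)
    (h : ∀ σ : Equiv.Perm (Fin n), σ o = o → stabTwist o σ ∈ G) :
    ∃ t ∈ G, t.right = Equiv.swap o p ∧ coeff t o = 1 ∧ coeff t p = 1 ∧
      ∀ a b, a ≠ o → a ≠ p → b ≠ o → b ≠ p → a ≠ b → coeff t b = -coeff t a := by
  obtain ⟨t, ht, htr, hto, htp⟩ := hG.exists_lift_swap hqo hqp
  refine ⟨t, ht, htr, hto, htp, fun a b hao hap hbo hbp hab => ?_⟩
  obtain ⟨s, h₁, h₂⟩ := hG.exists_coeff_commutator hao hap hbo hbp ht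
    (h (Equiv.swap a b) (Equiv.swap_apply_of_ne_of_ne hao.symm hbo.symm)) htr rfl
  simp only [coeff_stabTwist, if_neg hao, if_neg hop.symm, if_true, hto,
    Equiv.Perm.sign_swap hab, mul_one] at h₁ h₂
  generalize coeff t a = x at *
  generalize coeff t b = y at *
  revert s x y
  decide

/-- Three points other than `o` and `p` cannot have pairwise opposite signs. -/
theorem not_stabTwist_of_five_le (hG : IsSignExtension G) (hn : 5 ≤ n)
    (h : ∀ σ : Equiv.Perm (Fin n), σ ⟨0, by omega⟩ = ⟨0, by omega⟩ →
      stabTwist ⟨0, by omega⟩ σ ∈ G) : False := by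
  obtain ⟨t, -, -, -, -, ht⟩ := hG.exists_lift_swap_alternating (o := ⟨0, by omega⟩)
    (p := ⟨1, by omega⟩) (q := ⟨2, by omega⟩) (by simp) (by simp) (by simp) h
  have h₁ := ht ⟨2, by omega⟩ ⟨3, by omega⟩ (by simp) (by simp) (by simp) (by simp) (by simp)
  have h₂ := ht ⟨2, by omega⟩ ⟨4, by omega⟩ (by simp) (by simp) (by simp) (by simp) (by simp)
  have h₃ := ht ⟨3, by omega⟩ ⟨4, by omega⟩ (by simp) (by simp) (by simp) (by simp) (by simp)
  rw [h₂, h₁, neg_neg] at h₃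
  exact units_ne_neg_self _ h₃.symm

end IsSignExtension

/-! ### The exceptional subgroup and the classification -/

/-- The exceptional subgroup of `H₄`, by generators: `-1`, the stabilizer of `e₀`, acting on the
other coordinates by permutation matrices times their signature, and a lift of `swap 0 1`. -/
def exceptional : Subgroup (Hyperoctahedral 4) :=
  Subgroup.closure ({negOne 4, signedPerm ![1, 1, 1, -1] (Equiv.swap 0 1)} ∪
    stabTwist 0 '' {σ | σ 0 = 0})

/-- The group `exceptional` surjects onto the symmetric group, so a sign extension that
contains them is equal to it. -/
theorem IsSignExtension.eq_exceptional {G : Subgroup (Hyperoctahedral 4)}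
    (hG : IsSignExtension G) (h : ∀ σ : Equiv.Perm (Fin 4), σ 0 = 0 → stabTwist 0 σ ∈ G)
    (ht : signedPerm ![1, 1, 1, -1] (Equiv.swap 0 1) ∈ G) : exceptional = G := by
  refine hG.eq_of_le ?_ ?_ ?_
  · rw [exceptional, Subgroup.closure_le]
    rintro _ ((rfl | rfl) | ⟨σ, hσ, rfl⟩)
    exacts [hG.negOne_mem, ht, h σ hσ]
  · exact Subgroup.subset_closure (by simp)
  · refine Equiv.Perm.eq_top_of_stabilizer_of_swap (o := 0) (p := 1) (by decide)
      (fun σ hσ => ⟨stabTwist 0 σ, Subgroup.subset_closure (.inr ⟨σ, hσ, rfl⟩), rfl⟩)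
      ⟨_, Subgroup.subset_closure (.inl (.inr rfl)), rfl⟩

/-- A lift of `swap 0 1` has opposite signs at `2` and `3`; changing the sign of the `0`-th
coordinate exchanges the two possibilities up to `-1`. -/
theorem IsSignExtension.conjSubgroups_exceptional {G : Subgroup (Hyperoctahedral 4)}
    (hG : IsSignExtension G) (h : ∀ σ : Equiv.Perm (Fin 4), σ 0 = 0 → stabTwist 0 σ ∈ G) :
    ConjSubgroups G exceptional := by
  obtain ⟨t, ht, htr, ht₀, ht₁, ht'⟩ := hG.exists_lift_swap_alternating (o := 0) (p := 1) (q := 2)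
    (by decide) (by decide) (by decide) h
  have ht₃ := ht' 2 3 (by decide) (by decide) (by decide) (by decide) (by decide)
  let x : Hyperoctahedral 4 := SemidirectProduct.inl fun a => if a = 0 then coeff t 2 else 1
  refine ⟨x, (hG.map_conj x).eq_exceptional
    (fun σ hσ => ⟨_, h σ hσ, conj_single_of_fixed _ hσ⟩)
    ⟨diag 4 (coeff t 2) * t, G.mul_mem (hG.diag_mem _) ht, ?_⟩⟩
  refine ext_coeff ((right_conj_inl _ _).trans (by simp [htr])) fun a => ?_
  refine (coeff_conj_inl _ _ a).trans ?_
  have h₂ : Equiv.swap (0 : Fin 4) 1 2 = 2 := by decide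
  have h₃ : Equiv.swap (0 : Fin 4) 1 3 = 3 := by decide
  fin_cases a <;> simp [coeff_mul, htr, ht₀, ht₁, ht₃, h₂, h₃, Int.units_mul_self]

theorem IsSignExtension.conjSubgroups_of_three_le {G : Subgroup (Hyperoctahedral n)}
    (hG : IsSignExtension G) (hn : 3 ≤ n) :
    ConjSubgroups G (signSymm n) ∨ ∃ e : 4 = n, ConjSubgroups G (e ▸ exceptional) := by
  obtain ⟨d, h⟩ := hG.exists_conj_stabilizer ⟨0, by omega⟩
  have hG' := hG.map_conj (SemidirectProduct.inl d)
  have hd : ConjSubgroups G (G.map (MulAut.conj (SemidirectProduct.inl d)).toMonoidHom) :=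
    ⟨_, rfl⟩
  rcases h with h | ⟨h₄, h⟩
  · exact .inl (hd.trans (hG'.conjSubgroups_signSymm (o := ⟨0, by omega⟩) (p := ⟨1, by omega⟩)
      (q := ⟨2, by omega⟩) (by simp) (by simp) (by simp) h))
  · rcases h₄.lt_or_eq with h₅ | rfl
    · exact (hG'.not_stabTwist_of_five_le h₅ h).elim
    · exact .inr ⟨rfl, hd.trans (hG'.conjSubgroups_exceptional h)⟩

theorem signSymm_pow_eq_one {m : ℕ} (hm : Even m) (h : ∀ σ : Equiv.Perm (Fin n), σ ^ m = 1) :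
    ∀ x ∈ signSymm n, x ^ m = 1 := by
  rintro _ ⟨⟨s, σ⟩, rfl⟩
  obtain ⟨k, rfl⟩ := hm
  have hs : s ^ (k + k) = 1 := by rw [pow_add, Int.units_mul_self]
  rw [← map_pow, Prod.pow_mk, hs, h, ← Prod.one_eq_mk, map_one]

theorem IsSignExtension.conjSubgroups_or_mulEquiv_zmod_four {G : Subgroup (Hyperoctahedral 2)}
    (hG : IsSignExtension G) (hcard : Nat.card G = 4) :
    ConjSubgroups G (signSymm 2) ∨ Nonempty (G ≃* Multiplicative (ZMod 4)) := by
  obtain ⟨t, ht, htr, ht₀⟩ := hG.exists_mem_coeff_eq_one (Equiv.swap 0 1) 0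
  rcases Int.units_eq_one_or (coeff t 1) with ht₁ | ht₁
  · -- Now `t` is the permutation matrix of `swap 0 1`.
    have hts : SemidirectProduct.inr (Equiv.swap 0 1) = t :=
      ext_coeff htr.symm fun a => by fin_cases a <;> simp [ht₀, ht₁]
    refine .inl ⟨1, ?_⟩
    refine (hG.map_conj 1).eq_signSymm fun σ => ?_
    have hσ : ∀ σ : Equiv.Perm (Fin 2), σ = 1 ∨ σ = Equiv.swap 0 1 := by decide
    rcases hσ σ with rfl | rfl
    · rw [map_one]
      exact one_mem _
    · exact ⟨t, ht, by simp [hts]⟩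
  · -- Now `t` is a rotation by a right angle.
    have ht2 : t ^ 2 = negOne 2 := by
      refine ext_coeff (by simp [pow_two, htr]) fun a => ?_
      fin_cases a <;> simp [pow_two, coeff_mul, htr, ht₀, ht₁]
    have hne : ¬(⟨t, ht⟩ : G) ^ 2 ^ 1 = 1 := fun e =>
      negOne_ne_one (by norm_num) (ht2.symm.trans (congrArg Subtype.val e))
    have hpow : (⟨t, ht⟩ : G) ^ 2 ^ (1 + 1) = 1 := Subtype.ext <| by
      change t ^ (2 * 2) = 1
      rw [pow_mul, ht2, negOne, ← map_pow]
      simp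
    have : Finite G := Nat.finite_of_card_ne_zero (by simp [hcard])
    have : IsCyclic G := isCyclic_of_orderOf_eq_card ⟨t, ht⟩
      ((orderOf_eq_prime_pow hne hpow).trans hcard.symm)
    exact .inr ⟨mulEquivOfCyclicCardEq (by simp [hcard])⟩

theorem IsSignExtension.conjSubgroups_of_one {G : Subgroup (Hyperoctahedral 1)}
    (hG : IsSignExtension G) : ConjSubgroups G (signSymm 1) := by
  refine ⟨1, (hG.map_conj 1).eq_signSymm fun σ => ?_⟩
  rw [Subsingleton.elim σ 1, map_one]
  exact one_mem _

/-! ### The embedding of `GL₂(ℤ/3)` -/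

theorem matrix_eq_one_or_neg_one (M : Matrix (Fin 2) (Fin 2) (ZMod 3))
    (h : ∀ w, M *ᵥ w = w ∨ M *ᵥ w = -w) : M = 1 ∨ M = -1 := by
  have key : ∀ a b c d : ZMod 3,
      (∀ w, !![a, b; c, d] *ᵥ w = w ∨ !![a, b; c, d] *ᵥ w = -w) →
        !![a, b; c, d] = 1 ∨ !![a, b; c, d] = -1 := by
    decide
  rw [Matrix.eta_fin_two M] at h ⊢
  exact key _ _ _ _ h

section iota

variable {v : Fin 4 → Fin 2 → ZMod 3} (hv : IsPairReps v)

theorem iota_neg_one : iota v hv (-1) = negOne 4 := by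
  refine (hv.existsUnique_describes (-1)).unique (iota_describes v hv _) fun j => ?_
  change _ = (coeff (negOne 4) j).val • v j
  simp [Matrix.neg_mulVec]

theorem eq_one_or_neg_one_of_iota {g : GL (Fin 2) (ZMod 3)} (h : (iota v hv g).right = 1) :
    g = 1 ∨ g = -1 := by
  have hg : ∀ j, g.val *ᵥ v j = v j ∨ g.val *ᵥ v j = -v j := fun j => by
    have h₁ := iota_describes v hv g j
    rw [h, Equiv.Perm.one_apply] at h₁
    rcases Int.units_eq_one_or ((iota v hv g).left j) with hs | hs
    · exact .inl (by simpa [hs] using h₁)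
    · exact .inr (by simpa [hs] using h₁)
  have := matrix_eq_one_or_neg_one g.val fun w => by
    by_cases hw : w = 0
    · simp [hw]
    obtain ⟨j, rfl | rfl, -⟩ := hv.2 w hw
    · exact hg j
    · rw [Matrix.mulVec_neg, neg_inj, neg_neg, neg_eq_iff_eq_neg]
      exact hg j
  exact this.imp (fun e => Units.ext e) fun e => Units.ext e

theorem iota_injective : Function.Injective (iota v hv) := by
  refine (injective_iff_map_eq_one _).2 fun g hg => ?_
  refine (eq_one_or_neg_one_of_iota hv (by rw [hg]; rfl)).resolve_right ?_
  rintro rfl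
  exact negOne_ne_one (by norm_num) ((iota_neg_one hv).symm.trans hg)

/-- `PGL₂(ℤ/3)` acts faithfully on the four points of the projective line and has order `24`. -/
theorem map_proj_range_iota : (iota v hv).range.map (proj 4) = ⊤ := by
  rw [MonoidHom.map_range]
  have hker : Nat.card ((proj 4).comp (iota v hv)).ker = 2 := by
    refine (Nat.card_eq_two_iff' 1).2 ⟨⟨-1, ?_⟩, ?_, ?_⟩
    · simp [MonoidHom.mem_ker, iota_neg_one hv]
    · intro e
      refine negOne_ne_one (n := 4) (by norm_num) ?_
      have e' : (-1 : GL (Fin 2) (ZMod 3)) = 1 := congrArg Subtype.val e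
      rw [← iota_neg_one hv, e', map_one]
    · rintro ⟨g, hg⟩ hg₁
      exact Subtype.ext ((eq_one_or_neg_one_of_iota hv hg).resolve_left
        fun e => hg₁ (Subtype.ext e))
  have hcard := Subgroup.card_mul_index ((proj 4).comp (iota v hv)).ker
  have hGL : Nat.card (GL (Fin 2) (ZMod 3)) = 48 := by
    rw [Matrix.card_GL_field, Fin.prod_univ_two, ZMod.card]
    rfl
  rw [Subgroup.index_ker, hker, hGL] at hcard
  refine Subgroup.eq_top_of_card_eq _ ?_
  rw [Nat.card_perm, Nat.card_fin]
  change _ = 24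
  omega

theorem isSignExtension_range_iota : IsSignExtension (iota v hv).range where
  map_eq_top := map_proj_range_iota hv
  negOne_mem := ⟨-1, iota_neg_one hv⟩
  eq_of_right_eq_one := by
    rintro _ ⟨g, rfl⟩ h
    rcases eq_one_or_neg_one_of_iota hv h with rfl | rfl
    · exact .inl (map_one _)
    · exact .inr (iota_neg_one hv)

/-- `GL₂(ℤ/3)` has an element of order `8`, whereas the exponent of `{±1} × S₄` is `12`. -/
theorem not_conjSubgroups_iota_signSymm : ¬ConjSubgroups (iota v hv).range (signSymm 4) := by
  intro h
  let A : GL (Fin 2) (ZMod 3) := ⟨!![0, 1; 1, 1], !![-1, 1; 1, 0], by decide, by decide⟩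
  have hperm : ∀ σ : Equiv.Perm (Fin 4), σ ^ 12 = 1 := by
    set_option maxRecDepth 10000 in decide
  have h₁ := h.pow_eq_one (signSymm_pow_eq_one (by decide) hperm) _ ⟨A, rfl⟩
  rw [← map_pow] at h₁
  have h₂ := congrArg Units.val (iota_injective hv (h₁.trans (map_one _).symm))
  have h₃ : (!![0, 1; 1, 1] : Matrix (Fin 2) (Fin 2) (ZMod 3)) ^ 12 = 1 := h₂
  revert h₃
  decide

theorem conjSubgroups_iota_exceptional : ConjSubgroups (iota v hv).range exceptional := by
  obtain ⟨_, h⟩ := ((isSignExtension_range_iota hv).conjSubgroups_of_three_le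
    (by norm_num)).resolve_left (not_conjSubgroups_iota_signSymm hv)
  exact h

end iota

end Hyperoctahedral

open Hyperoctahedral in
theorem mainTheorem6 (n : ℕ) (hn : 1 ≤ n) :
    ((∀ G : Subgroup (Hyperoctahedral n),
        Nat.card G = n ! → G.map (Hyperoctahedral.proj n) = ⊤ →
          Hyperoctahedral.ConjSubgroups G (Hyperoctahedral.symm n) ∨
            Hyperoctahedral.ConjSubgroups G (Hyperoctahedral.symmTwist n)) ∧
      (Hyperoctahedral.ConjSubgroups (Hyperoctahedral.symm n) (Hyperoctahedral.symmTwist n) ↔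
        n ≤ 2)) ∧
    (∀ G : Subgroup (Hyperoctahedral n),
      Nat.card G = 2 * n ! → G.map (Hyperoctahedral.proj n) = ⊤ →
        Hyperoctahedral.negOne n ∈ G ∧
          ∀ (v : Fin 4 → Fin 2 → ZMod 3) (hv : Hyperoctahedral.IsPairReps v),
            Hyperoctahedral.ExactlyOne
              (Hyperoctahedral.ConjSubgroups G (Hyperoctahedral.signSymm n))
              (n = 2 ∧ Nonempty (G ≃* Multiplicative (ZMod 4)))
              (∃ e : 4 = n,
                Hyperoctahedral.ConjSubgroups G (e ▸ (Hyperoctahedral.iota v hv).range))) := by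
  refine ⟨⟨fun G => conjSubgroups_symm_or_symmTwist, conjSubgroups_symm_symmTwist_iff⟩,
    fun G hcard hπ => ?_⟩
  have hG := isSignExtension_of_card hn hcard hπ
  refine ⟨hG.negOne_mem, fun v hv => ⟨?_, ?_, ?_, ?_⟩⟩
  · obtain rfl | rfl | h₃ : n = 1 ∨ n = 2 ∨ 3 ≤ n := by omega
    · exact .inl hG.conjSubgroups_of_one
    · exact (hG.conjSubgroups_or_mulEquiv_zmod_four hcard).imp_right fun h => .inl ⟨rfl, h⟩
    · refine (hG.conjSubgroups_of_three_le h₃).imp_right fun ⟨e, h⟩ => .inr ⟨e, ?_⟩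
      subst e
      exact h.trans (conjSubgroups_iota_exceptional hv).symm
  · rintro ⟨h, rfl, ⟨f⟩⟩
    -- `{±1} · S₂` has exponent two.
    have h₁ := h.pow_eq_one (signSymm_pow_eq_one even_two (by decide)) _
      (f.symm (Multiplicative.ofAdd 1)).2
    have h₂ : f.symm (Multiplicative.ofAdd 1) ^ 2 = 1 := Subtype.ext h₁
    rw [← map_pow, map_eq_one_iff _ f.symm.injective] at h₂
    revert h₂
    decide
  · rintro ⟨h, rfl, h'⟩
    exact not_conjSubgroups_iota_signSymm hv (h'.symm.trans h)
  · rintro ⟨⟨rfl, -⟩, e, -⟩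
    exact absurd e (by decide)
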